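/- There is an absolute constant $K>0$ such that the following holds for every integer $N\ge 1$ and every concept class $\mathcal C\subseteq\{0,1\}^N$ (a concept $c\in\mathcal C$ is identified with a two-valued function on $[N]$). A classical membership query to $c$ returns $c_x$ for a point $x\in[N]$ chosen by the learner; a quantum membership query applies the unitary $|x,b\rangle\mapsto|x,b\oplus c_x\rangle$ (tensored with the identity on a finite workspace), and between queries a quantum learner may apply arbitrary unitaries that do not depend on $c$. A $T$-query classical learner is randomized and adaptive and always makes at most $T$ queries; a $q$-query quantum learner makes $q$ queries and ends with a measurement. A learner learns $\mathcal C$ if for every target $c\in\mathcal C$ it outputs exactly $c$ with probability at least $2/3$. Let $R(\mathcal C)$ and $Q(\mathcal C)$ be the minimal numbers of classical and quantum membership queries, respectively, of learners that learn $\mathcal C$. Then $$R(\mathcal C)\;\le\; K\,\frac{Q(\mathcal C)^2}{\log (Q(\mathcal C)+1)}\,\log|\mathcal C| ,$$ and if $N\ge 2$ then moreover $$\frac{Q(\mathcal C)^2}{\log (Q(\mathcal C)+1)}\,\log|\mathcal C|\;\le\; K\,\frac{Q(\mathcal C)^3}{\log (Q(\mathcal C)+1)}\,\log N .$$ More generally,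 if $\mathcal C$ can be learned with $q$ quantum membership queries, then it can be learned with some number $T$ of classical membership queries such that $T\le K\,\frac{q^2}{\log(q+1)}\log|\mathcal C|$, and if $N\ge2$ then $\frac{q^2}{\log(q+1)}\log|\mathcal C|\le K\,\frac{q^3}{\log(q+1)}\log N$. (Here $\log$ is the natural logarithm, and the expressions are read as $0$ when $q=0$, $Q(\mathcal C)=0$ or $\mathcal C=\emptyset$.) -/

import Mathlib

/-! Concepts over the domain `[N]` are `N`-bit strings `Fin N → Bool`; a concept class is a finite
set of such strings.  The truth values `1, -1` of a `±1`-valued concept are written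
`false, true`, so that the product of signs becomes `xor`. -/

namespace ExactLearning

/-- A deterministic adaptive classical learner: at a `node i` it makes the membership query `c i`
and continues in the first subtree if the answer is `false`, in the second one if it is `true`;
at a `leaf h` it stops and outputs the hypothesis `h`. -/
inductive DecisionTree (N : ℕ) : Type
  | leaf (h : Fin N → Bool) : DecisionTree N
  | node (i : Fin N) (tFalse tTrue : DecisionTree N) : DecisionTree N

namespace DecisionTree

/-- The hypothesis produced when the target concept is `c`. -/
def run {N : ℕ} (c : Fin N → Bool) : DecisionTree N → (Fin N → Bool)
  | leaf h => h
  | node i tFalse tTrue => if c i then tTrue.run c else tFalse.run c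

/-- The worst-case number of membership queries. -/
def depth {N : ℕ} : DecisionTree N → ℕ
  | leaf _ => 0
  | node _ tFalse tTrue => max tFalse.depth tTrue.depth + 1

end DecisionTree

/-- `C` can be exactly learned, with error probability at most `1/3` for every target concept, by
a randomized classical learner (a probability distribution over deterministic ones) that always
makes at most `T` membership queries. -/
def ClassicallyLearnable {N : ℕ} (C : Finset (Fin N → Bool)) (T : ℕ) : Prop :=
  ∃ p : PMF (DecisionTree N),
    (∀ t ∈ p.support, t.depth ≤ T) ∧ ∀ c ∈ C, 2 / 3 ≤ (p.map (DecisionTree.run c)) c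

/-- A quantum learner.  Its Hilbert space has the orthonormal basis `|x, b, w⟩`, where `x : Fin N`,
`b : Bool` is the answer qubit and `w` ranges over a finite workspace.  It starts in a fixed basis
state, applies the unitary `unitary 0`, and then alternates membership queries with the unitaries
`unitary 1`, `unitary 2`, and so on; finally the state is measured in this basis, and the
outcome `s` leads to the hypothesis `output s`. -/
structure QuantumLearner (N : ℕ) where
  Workspace : Type
  [fintypeWorkspace : Fintype Workspace]
  [decEqWorkspace : DecidableEq Workspace]
  start : Fin N × Bool × Workspace
  unitary : ℕ → Matrix.unitaryGroup (Fin N × Bool × Workspace) ℂ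
  output : Fin N × Bool × Workspace → (Fin N → Bool)

namespace QuantumLearner

attribute [instance] fintypeWorkspace decEqWorkspace

variable {N : ℕ}

/-- A quantum membership query: the linear map `|x, b, w⟩ ↦ |x, b ⊕ c x, w⟩`, written out on
amplitude vectors. -/
def query {W : Type} (c : Fin N → Bool) (ψ : Fin N × Bool × W → ℂ) : Fin N × Bool × W → ℂ :=
  fun s => ψ (s.1, xor s.2.1 (c s.1), s.2.2)

/-- The state (as a vector of amplitudes) just after the `t`-th query and the unitary following
it. -/
noncomputable def stateAfter (A : QuantumLearner N) (c : Fin N → Bool) :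
    ℕ → (Fin N × Bool × A.Workspace → ℂ)
  | 0 => (A.unitary 0).val.mulVec (Pi.single A.start 1)
  | t + 1 => (A.unitary (t + 1)).val.mulVec (query c (A.stateAfter c t))

open Classical in
/-- The probability that the learner, measuring after `T` queries, outputs the target concept. -/
noncomputable def successProb (A : QuantumLearner N) (c : Fin N → Bool) (T : ℕ) : ℝ :=
  ∑ s with A.output s = c, ‖A.stateAfter c T s‖ ^ 2

end QuantumLearner

/-- `C` can be exactly learned, with error probability at most `1/3` for every target concept, by
a quantum learner that makes `T` quantum membership queries. -/
def QuantumLearnable {N : ℕ} (C : Finset (Fin N → Bool)) (T : ℕ) : Prop :=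
  ∃ A : QuantumLearner N, ∀ c ∈ C, 2 / 3 ≤ A.successProb c T

/-- `R(C)`: the minimal number of classical membership queries of a bounded-error learner. -/
noncomputable def R {N : ℕ} (C : Finset (Fin N → Bool)) : ℕ :=
  sInf {T | ClassicallyLearnable C T}

/-- `Q(C)`: the minimal number of quantum membership queries of a bounded-error learner. -/
noncomputable def Q {N : ℕ} (C : Finset (Fin N → Bool)) : ℕ :=
  sInf {T | QuantumLearnable C T}

/-! Both minima are attained (querying all `N` points suffices), so they are never the infimum of
an empty set. -/

/-- The tree that queries the points of the list `l` and records the answers in `h`. -/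
def queryAll {N : ℕ} : List (Fin N) → (Fin N → Bool) → DecisionTree N
  | [], h => .leaf h
  | i :: l, h =>
      .node i (queryAll l (Function.update h i false)) (queryAll l (Function.update h i true))

theorem run_queryAll {N : ℕ} (c : Fin N → Bool) (l : List (Fin N)) (h : Fin N → Bool)
    (hl : ∀ j, j ∈ l ∨ h j = c j) : (queryAll l h).run c = c := by
  induction l generalizing h with
  | nil => funext j; simpa [queryAll, DecisionTree.run] using hl j
  | cons i l ih =>
    have key : ∀ b, c i = b → (queryAll l (Function.update h i b)).run c = c := by
      intro b hb
      refine ih _ fun j => ?_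
      by_cases hj : j = i
      · subst hj; right; simp [hb]
      · simpa [hj] using hl j
    rcases hc : c i with _ | _
    · simpa [queryAll, DecisionTree.run, hc] using key _ hc
    · simpa [queryAll, DecisionTree.run, hc] using key _ hc

theorem classicallyLearnable_R {N : ℕ} (C : Finset (Fin N → Bool)) :
    ClassicallyLearnable C (R C) := by
  refine Nat.sInf_mem (s := {T | ClassicallyLearnable C T}) ?_
  let t : DecisionTree N := queryAll (List.finRange N) (fun _ => false)
  refine ⟨t.depth, PMF.pure t, ?_, fun c _ => ?_⟩
  · intro s hs
    simp only [PMF.support_pure, Set.mem_singleton_iff] at hs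
    rw [hs]
  · have ht : t.run c = c := run_queryAll c _ _ fun j => Or.inl (List.mem_finRange j)
    rw [PMF.pure_map, ht]
    simpa using ENNReal.div_le_of_le_mul (by norm_num)

theorem successProb_of_basisState {N : ℕ} (A : QuantumLearner N) (c : Fin N → Bool) (T : ℕ)
    (s : Fin N × Bool × A.Workspace) (hs : A.stateAfter c T = Pi.single s 1)
    (ho : A.output s = c) : 2 / 3 ≤ A.successProb c T := by
  classical
  have h1 : ‖A.stateAfter c T s‖ ^ 2 = 1 := by rw [hs]; simp
  have h2 : ‖A.stateAfter c T s‖ ^ 2 ≤ A.successProb c T := by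
    refine Finset.single_le_sum (f := fun s => ‖A.stateAfter c T s‖ ^ 2)
      (fun _ _ => by positivity) ?_
    simp [ho]
  linarith

/-- `|x, b, w⟩ ↦ |x - 1, w (x - 1), w[x - 1 := b]⟩`; the matrix of the inverse permutation stores
the answer bit in the workspace and moves on to the next point. -/
def stepBack (N : ℕ) [NeZero N] : Equiv.Perm (Fin N × Bool × (Fin N → Bool)) where
  toFun s := (s.1 - 1, s.2.2 (s.1 - 1), Function.update s.2.2 (s.1 - 1) s.2.1)
  invFun s := (s.1 + 1, s.2.2 s.1, Function.update s.2.2 s.1 s.2.1)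
  left_inv s := by simp
  right_inv s := by simp

theorem permMatrix_mem_unitaryGroup {ι : Type} [Fintype ι] [DecidableEq ι] (σ : Equiv.Perm ι) :
    σ.permMatrix ℂ ∈ Matrix.unitaryGroup ι ℂ := by
  rw [Matrix.mem_unitaryGroup_iff, Matrix.star_eq_conjTranspose,
    Matrix.conjTranspose_permMatrix, ← Matrix.permMatrix_mul]
  simp

/-- The quantum learner that queries `0, 1, 2, …` in turn, moving each answer into the workspace. -/
noncomputable def queryAllQuantum (N : ℕ) [NeZero N] : QuantumLearner N where
  Workspace := Fin N → Bool
  start := (0, false, fun _ => false)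
  unitary t :=
    match t with
    | 0 => 1
    | _ + 1 => ⟨(stepBack N).permMatrix ℂ, permMatrix_mem_unitaryGroup _⟩
  output s := s.2.2

/-- The contents of the workspace of `queryAllQuantum` after `t` queries. -/
def recorded {N : ℕ} [NeZero N] (c : Fin N → Bool) : ℕ → (Fin N → Bool)
  | 0 => fun _ => false
  | t + 1 => Function.update (recorded c t) (Fin.ofNat N t) (c (Fin.ofNat N t))

theorem recorded_eq {N : ℕ} [NeZero N] (c : Fin N → Bool) (t : ℕ) (j : Fin N) (hj : j.val < t) :
    recorded c t j = c j := by
  induction t with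
  | zero => omega
  | succ t ih =>
    rw [recorded]
    by_cases h : j = Fin.ofNat N t
    · subst h; simp
    · rw [Function.update_of_ne h]
      refine ih (lt_of_le_of_ne (Nat.lt_succ_iff.mp hj) fun h' => h ?_)
      ext; simp [← h']

theorem recorded_eq_false {N : ℕ} [NeZero N] (c : Fin N → Bool) (t : ℕ) (j : Fin N)
    (hj : t ≤ j.val) : recorded c t j = false := by
  induction t with
  | zero => rfl
  | succ t ih =>
    rw [recorded, Function.update_of_ne]
    · exact ih (by omega)
    · rintro rfl
      have := Nat.mod_le t N
      simp at hj; omega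

theorem stateAfter_queryAllQuantum {N : ℕ} [NeZero N] (c : Fin N → Bool) (t : ℕ) (ht : t ≤ N) :
    (queryAllQuantum N).stateAfter c t =
      Pi.single (M := fun _ : Fin N × Bool × (Fin N → Bool) => ℂ)
        (Fin.ofNat N t, false, recorded c t) 1 := by
  induction t with
  | zero => exact Matrix.one_mulVec _
  | succ t ih =>
    have hf : recorded c t (Fin.ofNat N t) = false :=
      recorded_eq_false c t _ (by simp [Nat.mod_eq_of_lt ht])
    have h1 : Fin.ofNat N (t + 1) = Fin.ofNat N t + 1 := by
      ext; simp [Fin.val_add]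
    have hq : QuantumLearner.query c
          (Pi.single (M := fun _ : Fin N × Bool × (Fin N → Bool) => ℂ)
            (Fin.ofNat N t, false, recorded c t) 1) =
        Pi.single (Fin.ofNat N t, c (Fin.ofNat N t), recorded c t) 1 := by
      funext s
      obtain ⟨x, b, w⟩ := s
      simp only [QuantumLearner.query, Pi.single_apply, Prod.mk.injEq]
      congr 1
      by_cases hx : x = Fin.ofNat N t
      · subst hx; simp
      · simp only [hx, false_and]
    have hs : (Pi.single (M := fun _ : Fin N × Bool × (Fin N → Bool) => ℂ)
          (Fin.ofNat N t, c (Fin.ofNat N t), recorded c t) 1) ∘ (stepBack N) =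
        Pi.single (Fin.ofNat N (t + 1), false, recorded c (t + 1)) 1 := by
      have he : (Fin.ofNat N (t + 1), false, recorded c (t + 1)) =
          (stepBack N).symm (Fin.ofNat N t, c (Fin.ofNat N t), recorded c t) := by
        rw [h1, recorded, ← hf]; rfl
      funext s
      rw [he, Function.comp_apply, Pi.single_apply, Pi.single_apply]
      simp only [Equiv.eq_symm_apply]
    have h2 : (queryAllQuantum N).stateAfter c (t + 1) = ((stepBack N).permMatrix ℂ).mulVec
        (QuantumLearner.query c ((queryAllQuantum N).stateAfter c t)) := rfl
    refine h2.trans ?_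
    rw [ih (by omega)]
    refine (congrArg ((stepBack N).permMatrix ℂ).mulVec hq).trans ?_
    rw [Matrix.permMatrix_mulVec]
    exact hs

theorem quantumLearnable_Q {N : ℕ} (hN : 1 ≤ N) (C : Finset (Fin N → Bool)) :
    QuantumLearnable C (Q C) := by
  have : NeZero N := ⟨by omega⟩
  refine Nat.sInf_mem (s := {T | QuantumLearnable C T}) ⟨N, queryAllQuantum N, fun c _ => ?_⟩
  exact successProb_of_basisState _ c N _ (stateAfter_queryAllQuantum c N le_rfl)
    (funext fun j => recorded_eq c N j j.isLt)

end ExactLearning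

/-! Fix a distribution on the class. If no concept has more than 5/6 of the mass, a successful
quantum learner must drive the states of different concepts apart, so their average overlap drops
from 1 by a constant. If at every point some answer had share at most `r ^ 2`, each query would
lower this overlap by at most `2 * r`, which is too little over `q` queries once `r` is a small
multiple of `1 / q`. Hence some point gives both answers a share of at least `ρ`, of order `1 / q ^
2` (`exists_balanced_point`).

This holds for the restriction of the distribution to any subset, so a classical learner can keep
querying balanced points until one concept dominates. Such a query removes entropy at least `ρ * log
ρ⁻¹` per unit of mass (`massEntropy_split`), and the initial entropy is at most `log |C|`. So order
`q ^ 2 / log (q + 1) * log |C|` queries leave little mass undecided; the logarithmic saving is the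
factor `log ρ⁻¹` of the entropy of a biased bit. The minimax principle
(`classicallyLearnable_of_forall_weight`) turns these trees into one randomized learner.

The second inequality is a dimension count: the states after `q` queries span at most `(N + 1) ^ q`
dimensions, which bounds `|C|` (`card_le_of_quantumLearnable`). -/

namespace ExactLearning

/-! ### Overlaps of quantum states and the adversary bound -/

namespace QuantumLearner

/-- The permutation of the basis states performed by a membership query. -/
def queryPerm {N : ℕ} (W : Type) (c : Fin N → Bool) : Equiv.Perm (Fin N × Bool × W) where
  toFun s := (s.1, xor s.2.1 (c s.1), s.2.2)
  invFun s := (s.1, xor s.2.1 (c s.1), s.2.2)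
  left_inv s := by simp
  right_inv s := by simp

theorem query_apply {N : ℕ} {W : Type} (c : Fin N → Bool) (ψ : Fin N × Bool × W → ℂ)
    (s : Fin N × Bool × W) : query c ψ s = ψ (queryPerm W c s) := rfl

theorem queryPerm_congr {N : ℕ} {W : Type} {c d : Fin N → Bool} {s : Fin N × Bool × W}
    (h : c s.1 = d s.1) : queryPerm W c s = queryPerm W d s := by
  simp [queryPerm, h]

end QuantumLearner

/-- The real part of the inner product of two amplitude vectors. -/
noncomputable def overlap {ι : Type} [Fintype ι] (φ ψ : ι → ℂ) : ℝ :=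
  (star φ ⬝ᵥ ψ).re

theorem overlap_eq_sum {ι : Type} [Fintype ι] (φ ψ : ι → ℂ) :
    overlap φ ψ = ∑ s, (star (φ s) * ψ s).re := by
  simp [overlap, dotProduct]

theorem overlap_self {ι : Type} [Fintype ι] (φ : ι → ℂ) : overlap φ φ = ∑ s, ‖φ s‖ ^ 2 := by
  rw [overlap_eq_sum]
  refine Finset.sum_congr rfl fun s _ => ?_
  rw [Complex.star_def, ← Complex.normSq_eq_conj_mul_self, Complex.ofReal_re,
    Complex.normSq_eq_norm_sq]

theorem overlap_unitary {ι : Type} [Fintype ι] [DecidableEq ι] (U : Matrix.unitaryGroup ι ℂ)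
    (φ ψ : ι → ℂ) : overlap (U.val.mulVec φ) (U.val.mulVec ψ) = overlap φ ψ := by
  have h : star U.val * U.val = 1 := Matrix.mem_unitaryGroup_iff'.mp U.2
  rw [Matrix.star_eq_conjTranspose] at h
  rw [overlap, overlap, Matrix.star_mulVec, Matrix.dotProduct_mulVec, Matrix.vecMul_vecMul, h,
    Matrix.vecMul_one]

theorem re_star_mul_le (z w : ℂ) : (star z * w).re ≤ ‖z‖ * ‖w‖ := by
  calc (star z * w).re ≤ ‖star z * w‖ := Complex.re_le_norm _
    _ = ‖z‖ * ‖w‖ := by rw [norm_mul, norm_star]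

theorem neg_re_star_mul_le (z w : ℂ) : -(star z * w).re ≤ ‖z‖ * ‖w‖ := by
  calc -(star z * w).re ≤ |(star z * w).re| := neg_le_abs _
    _ ≤ ‖star z * w‖ := Complex.abs_re_le_norm _
    _ = ‖z‖ * ‖w‖ := by rw [norm_mul, norm_star]

theorem two_mul_le_of_mul_eq_one {a b : ℝ} (x y : ℝ) (ha : 0 ≤ a) (hab : a * b = 1) :
    2 * (x * y) ≤ a * x ^ 2 + b * y ^ 2 := by
  have ha' : 0 < a := lt_of_le_of_ne ha fun h => by rw [← h] at hab; simp at hab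
  have h : 0 ≤ a * (x - b * y) ^ 2 := by positivity
  have h2 : a * (x - b * y) ^ 2 = a * x ^ 2 - 2 * (a * b) * (x * y) + (a * b) * (b * y ^ 2) := by
    ring
  rw [h2, hab] at h
  linarith

namespace QuantumLearner

variable {N : ℕ}

theorem overlap_query_self {W : Type} [Fintype W] (c : Fin N → Bool)
    (φ ψ : Fin N × Bool × W → ℂ) : overlap (query c φ) (query c ψ) = overlap φ ψ := by
  simp only [overlap_eq_sum, query_apply]
  exact Equiv.sum_comp (queryPerm W c) fun s => (star (φ s) * ψ s).re

theorem sum_norm_sq_stateAfter (A : QuantumLearner N) (c : Fin N → Bool) (t : ℕ) :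
    ∑ s, ‖A.stateAfter c t s‖ ^ 2 = 1 := by
  rw [← overlap_self]
  induction t with
  | zero =>
    rw [stateAfter, overlap_unitary, overlap_self, Finset.sum_eq_single A.start]
    · simp
    · intro s _ hs
      simp [Pi.single_eq_of_ne hs]
    · simp
  | succ t ih => rw [stateAfter, overlap_unitary, overlap_query_self, ih]

/-- One pair of queries decreases the overlap by at most the weight of the points on which the
two concepts differ. -/
theorem overlap_sub_overlap_query_le {W : Type} [Fintype W] (c d : Fin N → Bool)
    (a b : Fin N → ℝ) (ha : ∀ x, 0 ≤ a x) (hab : ∀ x, c x ≠ d x → a x * b x = 1)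
    (φ ψ : Fin N × Bool × W → ℂ) :
    overlap φ ψ - overlap (query c φ) (query d ψ) ≤
      ∑ s, if c s.1 ≠ d s.1 then a s.1 * ‖φ s‖ ^ 2 + b s.1 * ‖ψ s‖ ^ 2 else 0 := by
  have hre : ∀ (e : Fin N → Bool) (f : Fin N → ℝ) (χ : Fin N × Bool × W → ℂ),
      ∑ s, f s.1 * ‖χ (queryPerm W e s)‖ ^ 2 = ∑ s, f s.1 * ‖χ s‖ ^ 2 := fun e f χ =>
    Equiv.sum_comp (queryPerm W e) fun s => f s.1 * ‖χ s‖ ^ 2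
  -- At a point of disagreement `φ` meets `ψ` twice, once permuted by `c` and once by `d`. Each
  -- product costs half of `a * ‖φ‖ ^ 2 + b * ‖ψ‖ ^ 2`, hence the full `a` in `F` and the `b / 2` in
  -- `G`.
  set F : Fin N → ℝ := fun x => if c x ≠ d x then a x else 0 with hF
  set G : Fin N → ℝ := fun x => if c x ≠ d x then b x / 2 else 0 with hG
  have hr : (∑ s : Fin N × Bool × W,
        if c s.1 ≠ d s.1 then a s.1 * ‖φ s‖ ^ 2 + b s.1 * ‖ψ s‖ ^ 2 else 0) =
      ∑ s, (F s.1 * ‖φ (queryPerm W c s)‖ ^ 2 + G s.1 * ‖ψ (queryPerm W c s)‖ ^ 2 +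
        G s.1 * ‖ψ (queryPerm W d s)‖ ^ 2) := by
    rw [Finset.sum_add_distrib, Finset.sum_add_distrib, hre, hre, hre, ← Finset.sum_add_distrib,
      ← Finset.sum_add_distrib]
    refine Finset.sum_congr rfl fun s _ => ?_
    simp only [hF, hG]
    split_ifs <;> ring
  -- Querying `c` on both states preserves the overlap, so the two overlaps compared differ only in
  -- the query applied to `ψ`.
  rw [hr, ← overlap_query_self c φ ψ, overlap_eq_sum, overlap_eq_sum, ← Finset.sum_sub_distrib]
  refine Finset.sum_le_sum fun s _ => ?_
  simp only [query_apply, hF, hG]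
  by_cases h : c s.1 = d s.1
  · rw [queryPerm_congr h]; simp [h]
  · have h1 := re_star_mul_le (φ (queryPerm W c s)) (ψ (queryPerm W c s))
    have h2 := neg_re_star_mul_le (φ (queryPerm W c s)) (ψ (queryPerm W d s))
    have h3 := two_mul_le_of_mul_eq_one ‖φ (queryPerm W c s)‖ ‖ψ (queryPerm W c s)‖ (ha s.1)
      (hab _ h)
    have h4 := two_mul_le_of_mul_eq_one ‖φ (queryPerm W c s)‖ ‖ψ (queryPerm W d s)‖ (ha s.1)
      (hab _ h)
    simp only [ne_eq, h, not_false_eq_true, if_true]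
    linarith

/-- The average overlap of the states of a learner, for a weight `μ` on the concepts. -/
noncomputable def progress (A : QuantumLearner N) (S : Finset (Fin N → Bool))
    (μ : (Fin N → Bool) → ℝ) (t : ℕ) : ℝ :=
  ∑ c ∈ S, ∑ d ∈ S, μ c * μ d * overlap (A.stateAfter c t) (A.stateAfter d t)

theorem progress_zero (A : QuantumLearner N) (S : Finset (Fin N → Bool))
    (μ : (Fin N → Bool) → ℝ) (h1 : ∑ c ∈ S, μ c = 1) : A.progress S μ 0 = 1 := by
  have h : ∀ c d, overlap (A.stateAfter c 0) (A.stateAfter d 0) = 1 := fun c d =>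
    (overlap_self _).trans (A.sum_norm_sq_stateAfter c 0)
  simp [progress, h, ← Finset.mul_sum, h1]

/-- The weights in the arithmetic-geometric inequality are tuned to the imbalance: `r` for the light
answer `m x`, `r⁻¹` for the other. A concept with the light answer disagrees with mass at most 1,
and one with the heavy answer with mass at most `r ^ 2`, so weight times disagreeing mass is at most
`r` either way. The two concepts of a pair contribute `r` each. -/
theorem progress_sub_succ_le (A : QuantumLearner N) (S : Finset (Fin N → Bool))
    (μ : (Fin N → Bool) → ℝ) (hμ : ∀ c ∈ S, 0 ≤ μ c) (h1 : ∑ c ∈ S, μ c = 1) {r : ℝ}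
    (hr : 0 < r) (hsplit : ∀ x, ∃ b, ∑ c ∈ S with c x = b, μ c ≤ r ^ 2) (t : ℕ) :
    A.progress S μ t - A.progress S μ (t + 1) ≤ 2 * r := by
  choose m hm using hsplit
  set w : Fin N → Bool → ℝ := fun x b => if b = m x then r else r⁻¹ with hw
  have hw0 : ∀ x b, 0 ≤ w x b := fun x b => by simp only [hw]; split_ifs <;> positivity
  have hw1 : ∀ x b b', b ≠ b' → w x b * w x b' = 1 := by
    intro x b b' h
    simp only [hw]
    cases b <;> cases b' <;> cases m x <;> simp_all [hr.ne']
  have hwp : ∀ x b, w x b * ∑ d ∈ S with d x ≠ b, μ d ≤ r := by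
    intro x b
    simp only [hw]
    split_ifs with hb
    · have : ∑ d ∈ S with d x ≠ b, μ d ≤ 1 := by
        rw [← h1]
        exact Finset.sum_le_sum_of_subset_of_nonneg (Finset.filter_subset _ _)
          fun c hc _ => hμ c hc
      nlinarith
    · have hf : (S.filter fun d => d x ≠ b) = S.filter fun d => d x = m x := by
        refine Finset.filter_congr fun d _ => ?_
        revert hb; cases b <;> cases m x <;> cases d x <;> simp
      rw [hf]
      calc r⁻¹ * ∑ d ∈ S with d x = m x, μ d ≤ r⁻¹ * r ^ 2 := by gcongr; exact hm x
        _ = r := by field_simp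
  set n : (Fin N → Bool) → Fin N × Bool × A.Workspace → ℝ := fun c s =>
    ‖A.stateAfter c t s‖ ^ 2 with hn
  have hpair : ∀ c d, overlap (A.stateAfter c t) (A.stateAfter d t) -
      overlap (A.stateAfter c (t + 1)) (A.stateAfter d (t + 1)) ≤
      ∑ s, if c s.1 ≠ d s.1 then w s.1 (c s.1) * n c s + w s.1 (d s.1) * n d s else 0 := by
    intro c d
    rw [stateAfter, stateAfter, overlap_unitary]
    exact overlap_sub_overlap_query_le c d (fun x => w x (c x)) (fun x => w x (d x))
      (fun x => hw0 _ _) (fun x h => hw1 _ _ _ h) _ _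
  have hhalf : ∑ s, ∑ c ∈ S, ∑ d ∈ S,
      μ c * μ d * (if c s.1 ≠ d s.1 then w s.1 (c s.1) * n c s else 0) ≤ r := by
    calc _ = ∑ s, ∑ c ∈ S, μ c * n c s * (w s.1 (c s.1) * ∑ d ∈ S with d s.1 ≠ c s.1, μ d) := by
          refine Finset.sum_congr rfl fun s _ => Finset.sum_congr rfl fun c _ => ?_
          rw [Finset.sum_filter, Finset.mul_sum, Finset.mul_sum]
          refine Finset.sum_congr rfl fun d _ => ?_
          simp only [ne_comm (a := c s.1)]
          split_ifs <;> ring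
      _ ≤ ∑ s, ∑ c ∈ S, μ c * n c s * r := by
          refine Finset.sum_le_sum fun s _ => Finset.sum_le_sum fun c hc => ?_
          exact mul_le_mul_of_nonneg_left (hwp _ _) (mul_nonneg (hμ c hc) (by positivity))
      _ = r := by
          rw [Finset.sum_comm]
          simp only [← Finset.sum_mul, ← Finset.mul_sum]
          simp [hn, sum_norm_sq_stateAfter, h1]
  calc A.progress S μ t - A.progress S μ (t + 1)
      = ∑ c ∈ S, ∑ d ∈ S, μ c * μ d * (overlap (A.stateAfter c t) (A.stateAfter d t) -
          overlap (A.stateAfter c (t + 1)) (A.stateAfter d (t + 1))) := by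
        simp only [progress, ← Finset.sum_sub_distrib, mul_sub]
    _ ≤ ∑ c ∈ S, ∑ d ∈ S, μ c * μ d *
          ∑ s, if c s.1 ≠ d s.1 then w s.1 (c s.1) * n c s + w s.1 (d s.1) * n d s else 0 :=
        Finset.sum_le_sum fun c hc => Finset.sum_le_sum fun d hd =>
          mul_le_mul_of_nonneg_left (hpair c d) (mul_nonneg (hμ c hc) (hμ d hd))
    _ = (∑ s, ∑ c ∈ S, ∑ d ∈ S,
          μ c * μ d * (if c s.1 ≠ d s.1 then w s.1 (c s.1) * n c s else 0)) +
        ∑ s, ∑ d ∈ S, ∑ c ∈ S,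
          μ d * μ c * (if d s.1 ≠ c s.1 then w s.1 (d s.1) * n d s else 0) := by
        rw [← Finset.sum_add_distrib]
        simp only [Finset.mul_sum]
        rw [Finset.sum_congr rfl fun c _ => Finset.sum_comm, Finset.sum_comm]
        refine Finset.sum_congr rfl fun s _ => ?_
        nth_rewrite 3 [Finset.sum_comm]
        rw [← Finset.sum_add_distrib]
        refine Finset.sum_congr rfl fun c _ => ?_
        rw [← Finset.sum_add_distrib]
        refine Finset.sum_congr rfl fun d _ => ?_
        simp only [ne_comm (a := d s.1)]
        split_ifs <;> ring
    _ ≤ 2 * r := by linarith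

theorem one_sub_progress_le (A : QuantumLearner N) (S : Finset (Fin N → Bool))
    (μ : (Fin N → Bool) → ℝ) (hμ : ∀ c ∈ S, 0 ≤ μ c) (h1 : ∑ c ∈ S, μ c = 1) {r : ℝ}
    (hr : 0 < r) (hsplit : ∀ x, ∃ b, ∑ c ∈ S with c x = b, μ c ≤ r ^ 2) (t : ℕ) :
    1 - A.progress S μ t ≤ t * (2 * r) := by
  induction t with
  | zero => simp [progress_zero A S μ h1]
  | succ t ih =>
    have := A.progress_sub_succ_le S μ hμ h1 hr hsplit t
    push_cast
    linarith

/-- States from which two different concepts are recognized are far from parallel. -/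
theorem overlap_le_of_successProb (A : QuantumLearner N) {c d : Fin N → Bool} (hcd : c ≠ d)
    (t : ℕ) (hc : 2 / 3 ≤ A.successProb c t) (hd : 2 / 3 ≤ A.successProb d t) :
    overlap (A.stateAfter c t) (A.stateAfter d t) ≤ 17 / 18 := by
  classical
  have nc := A.sum_norm_sq_stateAfter c t
  have nd := A.sum_norm_sq_stateAfter d t
  have hd' : ∑ s with A.output s = d, ‖A.stateAfter d t s‖ ^ 2 ≤
      ∑ s with ¬ A.output s = c, ‖A.stateAfter d t s‖ ^ 2 := by
    refine Finset.sum_le_sum_of_subset_of_nonneg (fun s hs => ?_) fun s _ _ => by positivity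
    simp only [Finset.mem_filter, Finset.mem_univ, true_and] at hs ⊢
    rw [hs]; exact hcd.symm
  have sc := Finset.sum_filter_add_sum_filter_not Finset.univ (fun s => A.output s = c)
    fun s => ‖A.stateAfter c t s‖ ^ 2
  have sd := Finset.sum_filter_add_sum_filter_not Finset.univ (fun s => A.output s = c)
    fun s => ‖A.stateAfter d t s‖ ^ 2
  have hb : ∀ (a b : ℝ), 0 ≤ a → a * b = 1 → ∀ F : Finset (Fin N × Bool × A.Workspace),
      2 * ∑ s ∈ F, (star (A.stateAfter c t s) * A.stateAfter d t s).re ≤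
        a * ∑ s ∈ F, ‖A.stateAfter c t s‖ ^ 2 + b * ∑ s ∈ F, ‖A.stateAfter d t s‖ ^ 2 := by
    intro a b ha hab F
    rw [Finset.mul_sum, Finset.mul_sum, Finset.mul_sum, ← Finset.sum_add_distrib]
    refine Finset.sum_le_sum fun s _ => ?_
    have h1 := re_star_mul_le (A.stateAfter c t s) (A.stateAfter d t s)
    have h2 := two_mul_le_of_mul_eq_one ‖A.stateAfter c t s‖ ‖A.stateAfter d t s‖ ha hab
    linarith
  -- On the outcomes for `c` the first state has mass at least 2/3 and the second at most 1/3, and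
  -- the weights favour this imbalance. Doubled, the overlap is at most `13 / 6 - 5 / 6 * (2 / 3 - 1
  -- / 3) = 17 / 9`.
  have b1 := hb (2 / 3) (3 / 2) (by norm_num) (by norm_num)
    (Finset.univ.filter fun s => A.output s = c)
  have b2 := hb (3 / 2) (2 / 3) (by norm_num) (by norm_num)
    (Finset.univ.filter fun s => ¬ A.output s = c)
  rw [overlap_eq_sum, ← Finset.sum_filter_add_sum_filter_not Finset.univ
    (fun s => A.output s = c)]
  have hc2 : 2 / 3 ≤ ∑ s with A.output s = c, ‖A.stateAfter c t s‖ ^ 2 := by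
    rw [successProb] at hc
    convert hc
  have hd2 : 2 / 3 ≤ ∑ s with A.output s = d, ‖A.stateAfter d t s‖ ^ 2 := by
    rw [successProb] at hd
    convert hd
  linarith

/-- Two independent draws from `μ` differ with probability at least 1/6, and a differing pair loses
1/18 of overlap; the product is 1/108. -/
theorem progress_le (A : QuantumLearner N) (S : Finset (Fin N → Bool))
    (μ : (Fin N → Bool) → ℝ) (hμ : ∀ c ∈ S, 0 ≤ μ c) (h1 : ∑ c ∈ S, μ c = 1)
    (hatom : ∀ c ∈ S, μ c ≤ 5 / 6) (t : ℕ) (hA : ∀ c ∈ S, 2 / 3 ≤ A.successProb c t) :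
    A.progress S μ t ≤ 1 - 1 / 108 := by
  have hpair : ∀ c ∈ S, ∀ d ∈ S, overlap (A.stateAfter c t) (A.stateAfter d t) ≤
      17 / 18 + if c = d then 1 / 18 else 0 := by
    intro c hc d hd
    split_ifs with h
    · rw [h, overlap_self, sum_norm_sq_stateAfter]; norm_num
    · linarith [A.overlap_le_of_successProb h t (hA c hc) (hA d hd)]
  calc A.progress S μ t
      ≤ ∑ c ∈ S, ∑ d ∈ S, μ c * μ d * (17 / 18 + if c = d then 1 / 18 else 0) :=
        Finset.sum_le_sum fun c hc => Finset.sum_le_sum fun d hd =>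
          mul_le_mul_of_nonneg_left (hpair c hc d hd) (mul_nonneg (hμ c hc) (hμ d hd))
    _ = ∑ c ∈ S, μ c * (17 / 18 + μ c * (1 / 18)) := by
        refine Finset.sum_congr rfl fun c hc => ?_
        simp only [mul_add, Finset.sum_add_distrib, mul_ite, mul_zero]
        rw [Finset.sum_ite_eq, if_pos hc, ← Finset.sum_mul, ← Finset.mul_sum, h1]
        ring
    _ ≤ ∑ c ∈ S, μ c * (1 - 1 / 108) := by
        refine Finset.sum_le_sum fun c hc => mul_le_mul_of_nonneg_left ?_ (hμ c hc)
        linarith [hatom c hc]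
    _ = 1 - 1 / 108 := by rw [← Finset.sum_mul, h1, one_mul]

end QuantumLearner

/-- The adversary lower bound: for every weight without a dominating concept there is a point that
splits it in a balanced way. -/
theorem exists_balanced_point {N : ℕ} {C : Finset (Fin N → Bool)} {q : ℕ}
    (hC : QuantumLearnable C q) {S : Finset (Fin N → Bool)} (hS : S ⊆ C)
    (μ : (Fin N → Bool) → ℝ) (hμ : ∀ c ∈ S, 0 ≤ μ c) (hpos : 0 < ∑ c ∈ S, μ c)
    (hatom : ∀ c ∈ S, μ c ≤ 5 / 6 * ∑ c ∈ S, μ c) {r : ℝ} (hr : 0 < r)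
    (hqr : q * (2 * r) < 1 / 108) :
    ∃ x, ∀ b, r ^ 2 * ∑ c ∈ S, μ c ≤ ∑ c ∈ S with c x = b, μ c := by
  obtain ⟨A, hA⟩ := hC
  by_contra! hcon
  set M := ∑ c ∈ S, μ c with hM
  have h1 : ∑ c ∈ S, μ c / M = 1 := by rw [← Finset.sum_div, ← hM, div_self hpos.ne']
  have hμ' : ∀ c ∈ S, 0 ≤ μ c / M := fun c hc => div_nonneg (hμ c hc) hpos.le
  have h2 := A.one_sub_progress_le S (fun c => μ c / M) hμ' h1 hr (fun x => by
    obtain ⟨b, hb⟩ := hcon x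
    refine ⟨b, ?_⟩
    rw [← Finset.sum_div, div_le_iff₀ hpos]
    exact hb.le) q
  have h3 := A.progress_le S (fun c => μ c / M) hμ' h1
    (fun c hc => by rw [div_le_iff₀ hpos]; exact hatom c hc) q fun c hc => hA c (hS hc)
  linarith

/-! ### Entropy and the greedy decision tree -/

/-- The unnormalized entropy of the weight `μ` on `S`. -/
noncomputable def massEntropy {α : Type} (S : Finset α) (μ : α → ℝ) : ℝ :=
  ∑ c ∈ S, Real.negMulLog (μ c) - Real.negMulLog (∑ c ∈ S, μ c)

theorem massEntropy_nonneg {α : Type} (S : Finset α) (μ : α → ℝ) (hμ : ∀ c ∈ S, 0 ≤ μ c) :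
    0 ≤ massEntropy S μ := by
  rw [massEntropy, Real.negMulLog, neg_mul, Finset.sum_mul, ← Finset.sum_neg_distrib,
    ← Finset.sum_sub_distrib]
  refine Finset.sum_nonneg fun c hc => ?_
  rcases (hμ c hc).eq_or_lt with h | h
  · simp [← h]
  · have := Real.log_le_log h (Finset.single_le_sum hμ hc)
    rw [Real.negMulLog]
    nlinarith

theorem massEntropy_le_log_card {α : Type} (S : Finset α) (μ : α → ℝ) (hμ : ∀ c ∈ S, 0 ≤ μ c)
    (h1 : ∑ c ∈ S, μ c = 1) : massEntropy S μ ≤ Real.log S.card := by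
  have hne : S.Nonempty := by
    rw [Finset.nonempty_iff_ne_empty]
    rintro rfl
    simp at h1
  have hn : (0 : ℝ) < S.card := by exact_mod_cast hne.card_pos
  have h := Real.concaveOn_negMulLog.le_map_sum (t := S) (w := fun _ => (S.card : ℝ)⁻¹) (p := μ)
    (fun _ _ => by positivity) (by simp [hn.ne']) hμ
  simp only [smul_eq_mul, ← Finset.mul_sum, h1, mul_one] at h
  rw [massEntropy, h1, Real.negMulLog_one, sub_zero]
  rw [inv_mul_le_iff₀ hn, Real.negMulLog, Real.log_inv] at h
  calc _ ≤ _ := h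
    _ = Real.log S.card := by field_simp

theorem sum_filter_bool {N : ℕ} (S : Finset (Fin N → Bool)) (x : Fin N)
    (f : (Fin N → Bool) → ℝ) :
    ∑ c ∈ S with c x = false, f c + ∑ c ∈ S with c x = true, f c = ∑ c ∈ S, f c := by
  rw [← Finset.sum_filter_add_sum_filter_not S (fun c => c x = false) f]
  simp

/-- By the chain rule the entropy lost is the total mass times the binary entropy of the split. The
split lies in `[ρ, 1 - ρ]`, where the binary entropy is at least its value at `ρ`, and a single
summand of that value is already `ρ * log ρ⁻¹`. -/
theorem massEntropy_split {N : ℕ} (S : Finset (Fin N → Bool)) (μ : (Fin N → Bool) → ℝ)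
    (x : Fin N) {ρ : ℝ} (hρ : 0 < ρ)
    (hS : 0 < ∑ c ∈ S, μ c)
    (hx : ∀ b, ρ * ∑ c ∈ S, μ c ≤ ∑ c ∈ S with c x = b, μ c) :
    massEntropy (S.filter fun c => c x = false) μ + massEntropy (S.filter fun c => c x = true) μ
      + ρ * Real.log ρ⁻¹ * ∑ c ∈ S, μ c ≤ massEntropy S μ := by
  have h0 := hx false
  have h1 := hx true
  have hs := sum_filter_bool S x μ
  have hn := sum_filter_bool S x fun c => Real.negMulLog (μ c)
  simp only [massEntropy]
  set a := ∑ c ∈ S with c x = false, μ c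
  set b := ∑ c ∈ S with c x = true, μ c
  set M := ∑ c ∈ S, μ c
  set p := a / M with hp
  have ha : a = M * p := by rw [hp]; field_simp
  have hb : b = M * (1 - p) := by rw [mul_sub, ← ha]; linarith
  have hp0 : ρ ≤ p := by rw [hp, le_div_iff₀ hS]; exact h0
  have hp1 : ρ ≤ 1 - p := by
    rw [hb, mul_comm] at h1
    exact le_of_mul_le_mul_left h1 hS
  have hbin : ρ * Real.log ρ⁻¹ ≤ Real.binEntropy p := by
    have hle : Real.binEntropy ρ ≤ Real.binEntropy p := by
      rcases le_total p 2⁻¹ with h | h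
      · exact Real.binEntropy_strictMonoOn.monotoneOn ⟨hρ.le, hp0.trans h⟩
          ⟨hρ.le.trans hp0, h⟩ hp0
      · rw [← Real.binEntropy_one_sub p]
        have h' : 1 - p ≤ 2⁻¹ := by norm_num at h ⊢; linarith
        exact Real.binEntropy_strictMonoOn.monotoneOn ⟨hρ.le, hp1.trans h'⟩
          ⟨hρ.le.trans hp1, h'⟩ hp1
    refine le_trans ?_ hle
    rw [Real.binEntropy_eq_negMulLog_add_negMulLog_one_sub, Real.negMulLog, Real.log_inv]
    have := Real.negMulLog_nonneg (x := 1 - ρ) (by linarith) (by linarith)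
    linarith
  have key : Real.negMulLog a + Real.negMulLog b = Real.negMulLog M + M * Real.binEntropy p := by
    rw [ha, hb, Real.negMulLog_mul, Real.negMulLog_mul,
      Real.binEntropy_eq_negMulLog_add_negMulLog_one_sub]
    ring
  have := mul_le_mul_of_nonneg_right hbin hS.le
  linarith

/-- The greedy tree: it stops when one concept dominates and otherwise queries a balanced point.
The weight `U` is the one on which it runs out of queries. -/
theorem exists_decisionTree_error_le {N : ℕ} (C : Finset (Fin N → Bool))
    (μ : (Fin N → Bool) → ℝ) (hμ : ∀ c ∈ C, 0 ≤ μ c) {ρ : ℝ} (hρ : 0 < ρ)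
    (hbal : ∀ S ⊆ C, 0 < ∑ c ∈ S, μ c → (∀ c ∈ S, μ c ≤ 5 / 6 * ∑ c ∈ S, μ c) →
      ∃ x, ∀ b, ρ * ∑ c ∈ S, μ c ≤ ∑ c ∈ S with c x = b, μ c)
    (T : ℕ) (S : Finset (Fin N → Bool)) (hS : S ⊆ C) :
    ∃ (t : DecisionTree N) (U : ℝ), t.depth ≤ T ∧ U ≤ ∑ c ∈ S, μ c ∧
      ∑ c ∈ S with t.run c ≠ c, μ c ≤ 1 / 6 * ∑ c ∈ S, μ c + U ∧
      T * (ρ * Real.log ρ⁻¹) * U ≤ massEntropy S μ := by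
  induction T generalizing S with
  | zero =>
    have h0 := Finset.sum_nonneg fun c hc => hμ c (hS hc)
    refine ⟨.leaf fun _ => false, ∑ c ∈ S, μ c, le_rfl, le_rfl, ?_, ?_⟩
    · have := Finset.sum_le_sum_of_subset_of_nonneg (Finset.filter_subset
        (fun c => (DecisionTree.leaf fun _ => false).run c ≠ c) S) fun c hc _ => hμ c (hS hc)
      linarith
    · simpa using massEntropy_nonneg S μ fun c hc => hμ c (hS hc)
  | succ T ih =>
    have h0 := Finset.sum_nonneg fun c hc => hμ c (hS hc)
    have hE := massEntropy_nonneg S μ fun c hc => hμ c (hS hc)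
    by_cases hatom : ∃ h, ∑ c ∈ S with h ≠ c, μ c ≤ 1 / 6 * ∑ c ∈ S, μ c
    -- A leaf naming the dominating concept errs on at most a sixth of the mass. If no leaf achieves
    -- this, every concept has mass below 5/6 of the total and `hbal` applies.
    · obtain ⟨h, hh⟩ := hatom
      exact ⟨.leaf h, 0, Nat.zero_le _, h0, by rw [add_zero]; convert hh; rfl, by simpa using hE⟩
    · push Not at hatom
      have hle : ∀ h, ∑ c ∈ S with h ≠ c, μ c ≤ ∑ c ∈ S, μ c := fun h =>
        Finset.sum_le_sum_of_subset_of_nonneg (Finset.filter_subset _ S)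
          fun c hc _ => hμ c (hS hc)
      have hpos : 0 < ∑ c ∈ S, μ c := by
        linarith [hatom fun _ => false, hle fun _ => false]
      obtain ⟨x, hx⟩ := hbal S hS hpos fun c hc => by
        have h1 := hatom c
        have h2 := Finset.sum_filter_add_sum_filter_not S (fun d => c = d) μ
        rw [Finset.sum_filter, Finset.sum_ite_eq, if_pos hc] at h2
        linarith
      have hent := massEntropy_split S μ x hρ hpos hx
      obtain ⟨t₀, U₀, hd₀, hU₀, he₀, hp₀⟩ := ih (S.filter fun c => c x = false)
        ((Finset.filter_subset _ _).trans hS)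
      obtain ⟨t₁, U₁, hd₁, hU₁, he₁, hp₁⟩ := ih (S.filter fun c => c x = true)
        ((Finset.filter_subset _ _).trans hS)
      have hsum := sum_filter_bool S x μ
      have hlog : 0 ≤ ρ * Real.log ρ⁻¹ := by
        refine mul_nonneg hρ.le (Real.log_nonneg ?_)
        have h1 := hx true
        have h2 : ∑ c ∈ S with c x = true, μ c ≤ ∑ c ∈ S, μ c :=
          Finset.sum_le_sum_of_subset_of_nonneg (Finset.filter_subset _ S)
            fun c hc _ => hμ c (hS hc)
        exact (one_le_inv₀ hρ).mpr (by nlinarith)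
      refine ⟨.node x t₀ t₁, U₀ + U₁, ?_, by linarith, ?_, ?_⟩
      · simp only [DecisionTree.depth]; omega
      · rw [Finset.sum_filter, ← sum_filter_bool S x]
        have e₀ : ∑ c ∈ S with c x = false, (if (DecisionTree.node x t₀ t₁).run c ≠ c
            then μ c else 0) = ∑ c ∈ S.filter (fun c => c x = false) with t₀.run c ≠ c, μ c := by
          rw [Finset.sum_filter (s := S.filter _)]
          refine Finset.sum_congr rfl fun c hc => ?_
          simp [DecisionTree.run, (Finset.mem_filter.mp hc).2]
        have e₁ : ∑ c ∈ S with c x = true, (if (DecisionTree.node x t₀ t₁).run c ≠ c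
            then μ c else 0) = ∑ c ∈ S.filter (fun c => c x = true) with t₁.run c ≠ c, μ c := by
          rw [Finset.sum_filter (s := S.filter _)]
          refine Finset.sum_congr rfl fun c hc => ?_
          simp [DecisionTree.run, (Finset.mem_filter.mp hc).2]
        rw [e₀, e₁]
        linarith
      -- The subtrees pay for `T` of the `T + 1` queries; the query at the root is paid by the
      -- entropy drop, since the undecided mass is at most the mass of `S`.
      · have hU : ρ * Real.log ρ⁻¹ * (U₀ + U₁) ≤ ρ * Real.log ρ⁻¹ * ∑ c ∈ S, μ c :=
          mul_le_mul_of_nonneg_left (by linarith) hlog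
        push_cast
        linarith

/-! ### From distributions to randomized learners -/

/-- The minimax principle: it suffices to learn against every fixed distribution on `C`. -/
theorem classicallyLearnable_of_forall_weight {N : ℕ} (C : Finset (Fin N → Bool)) (T : ℕ)
    (h : ∀ μ : (Fin N → Bool) → ℝ, (∀ c, 0 ≤ μ c) → ∑ c ∈ C, μ c = 1 →
      ∃ t : DecisionTree N, t.depth ≤ T ∧ 2 / 3 ≤ ∑ c ∈ C with t.run c = c, μ c) :
    ClassicallyLearnable C T := by
  let score : DecisionTree N → (C → ℝ) := fun t c => if t.run c = c then 1 else 0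
  let V : Set (C → ℝ) := score '' {t | t.depth ≤ T}
  have hV : V.Finite := by
    refine (Set.Finite.pi' (t := fun _ : C => ({0, 1} : Set ℝ)) fun _ =>
      Set.toFinite _).subset ?_
    rintro _ ⟨t, -, rfl⟩ c
    by_cases hc : t.run c = c <;> simp [score, hc]
  let Z : Set (C → ℝ) := {v | ∀ c, 2 / 3 ≤ v c}
  have hZc : Convex ℝ Z := by
    have : Z = Set.Ici (fun _ => 2 / 3) := rfl
    rw [this]; exact convex_Ici _
  have hZcl : IsClosed Z := isClosed_Ici (a := fun _ : C => (2 / 3 : ℝ))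
  -- A common point of the hull and `Z` is a mixture of trees that succeeds on every concept.
  -- Otherwise a separating functional, once shown nonnegative and nonzero, normalizes to a
  -- distribution that defeats every tree.
  by_cases hdis : Disjoint (convexHull ℝ V) Z
  · exfalso
    obtain ⟨f, u, v, hfu, huv, hfv⟩ := geometric_hahn_banach_compact_closed
      (convex_convexHull ℝ V) (hV.isCompact_convexHull ℝ) hZc hZcl hdis
    set g : C → ℝ := fun c => f (Pi.single c 1) with hg
    have hf : ∀ y : C → ℝ, f y = ∑ c, y c * g c := by
      intro y
      have hy : y = ∑ c, y c • (Pi.single c 1 : { x // x ∈ C } → ℝ) := by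
        funext d
        simp [Finset.sum_apply, Pi.single_apply]
      conv_lhs => rw [hy]
      simp [map_sum, hg]
    have hg0 : ∀ c, 0 ≤ g c := by
      intro c
      by_contra! hneg
      -- `Z` is closed under raising a coordinate, so a negative coefficient would make `f`
      -- unbounded below on it.
      have hz : ∀ n : ℕ, v < 2 / 3 * ∑ d, g d + n * g c := by
        intro n
        have := hfv (fun d => 2 / 3 + if d = c then (n : ℝ) else 0) fun d => by
          have : (0 : ℝ) ≤ if d = c then (n : ℝ) else 0 := by split_ifs <;> simp
          exact le_add_of_nonneg_right this
        rw [hf] at this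
        simpa [add_mul, Finset.sum_add_distrib, ← Finset.mul_sum] using this
      obtain ⟨n, hn⟩ := exists_nat_gt ((2 / 3 * ∑ d, g d - v) / -g c)
      rw [div_lt_iff₀ (by linarith)] at hn
      linarith [hz n]
    have hz := hfv (fun _ => 2 / 3) fun _ => le_rfl
    rw [hf, ← Finset.mul_sum] at hz
    set G := ∑ c, g c with hG
    have hGpos : 0 < G := by
      rcases (Finset.sum_nonneg fun c _ => hg0 c : 0 ≤ G).eq_or_lt with h0 | h0
      · exfalso
        have hall : ∀ c, g c = 0 := fun c =>
          (Finset.sum_eq_zero_iff_of_nonneg fun c _ => hg0 c).mp h0.symm c (Finset.mem_univ c)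
        have h1 := hfu (score (.leaf fun _ => false))
          (subset_convexHull ℝ V ⟨_, Nat.zero_le T, rfl⟩)
        rw [hf] at h1
        simp only [hall, mul_zero, Finset.sum_const_zero] at h1
        linarith
      · exact h0
    let μ : (Fin N → Bool) → ℝ := fun c => if hc : c ∈ C then g ⟨c, hc⟩ / G else 0
    have hμ : ∀ c : C, μ c = g c / G := fun c => by simp [μ]
    obtain ⟨t, ht, hs⟩ := h μ
      (fun c => by simp only [μ]; split_ifs; exacts [div_nonneg (hg0 _) hGpos.le, le_rfl])
      (by rw [← Finset.sum_coe_sort]; simp only [hμ]; rw [← Finset.sum_div, ← hG, div_self hGpos.ne'])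
    have h1 := hfu (score t) (subset_convexHull ℝ V ⟨t, ht, rfl⟩)
    have h2 : ∑ c ∈ C with t.run c = c, μ c = f (score t) / G := by
      rw [Finset.sum_filter, ← Finset.sum_coe_sort, hf, Finset.sum_div]
      refine Finset.sum_congr rfl fun c _ => ?_
      simp only [score, hμ]
      split_ifs <;> simp
    rw [h2, le_div_iff₀ hGpos] at hs
    linarith
  · obtain ⟨y, hy, hyZ⟩ := Set.not_disjoint_iff.mp hdis
    obtain ⟨ι, _, w, z, hw0, hw1, hz, rfl⟩ := mem_convexHull_iff_exists_fintype.mp hy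
    choose t ht hts using hz
    have hP : ∑ i, ENNReal.ofReal (w i) = 1 := by
      rw [← ENNReal.ofReal_sum_of_nonneg fun i _ => hw0 i, hw1, ENNReal.ofReal_one]
    refine ⟨(PMF.ofFintype (fun i => ENNReal.ofReal (w i)) hP).map t, ?_, ?_⟩
    · intro s hs
      obtain ⟨i, -, rfl⟩ := (PMF.mem_support_map_iff _ _ _).mp hs
      exact ht i
    · intro c hc
      classical
      have h1 : 2 / 3 ≤ ∑ i, w i * (if (t i).run c = c then 1 else 0) := by
        have := hyZ ⟨c, hc⟩
        simpa [Finset.sum_apply, ← hts, score] using this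
      rw [PMF.map_comp, PMF.map_apply, tsum_fintype]
      calc (2 / 3 : ENNReal) = ENNReal.ofReal (2 / 3) := by
            rw [ENNReal.ofReal_div_of_pos (by norm_num)]; simp
        _ ≤ ENNReal.ofReal (∑ i, w i * (if (t i).run c = c then 1 else 0)) :=
            ENNReal.ofReal_le_ofReal h1
        _ = _ := by
            rw [ENNReal.ofReal_sum_of_nonneg fun i _ =>
              mul_nonneg (hw0 i) (by split_ifs <;> norm_num)]
            refine Finset.sum_congr rfl fun i _ => ?_
            by_cases hi : (t i).run c = c
            · simp [hi]
            · simp [hi, Ne.symm hi]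

/-! ### Dimension bound on the size of the class -/

namespace QuantumLearner

variable {N : ℕ}

/-- After `t` queries the state lies in a space of dimension at most `(N + 1) ^ t` that does not
depend on the target concept. -/
theorem exists_spanning_family (A : QuantumLearner N) (t : ℕ) :
    ∃ v : (Fin t → Option (Fin N)) → (Fin N × Bool × A.Workspace → ℂ),
      ∀ c, A.stateAfter c t ∈ Submodule.span ℂ (Set.range v) := by
  induction t with
  | zero => exact ⟨fun _ => A.stateAfter (fun _ => false) 0, fun c =>
      Submodule.subset_span ⟨Fin.elim0, rfl⟩⟩
  | succ t ih =>
    obtain ⟨v, hv⟩ := ih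
    -- A query is affine in the bits of `c`: `flip none` is the identity, and `flip (some x)` is the
    -- change caused by `c x = true`. These `N + 1` maps do not depend on `c`, and each query picks
    -- one of them.
    let flip : Option (Fin N) → (Fin N × Bool × A.Workspace → ℂ) →ₗ[ℂ]
        (Fin N × Bool × A.Workspace → ℂ) := fun o =>
      { toFun := fun ψ s => o.elim (ψ s) fun x => if s.1 = x then
          ψ (s.1, !s.2.1, s.2.2) - ψ s else 0
        map_add' := fun ψ φ => by
          funext s
          cases o with
          | none => rfl
          | some x => simp only [Option.elim_some, Pi.add_apply]; split_ifs <;> ring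
        map_smul' := fun a ψ => by
          funext s
          cases o with
          | none => rfl
          | some x =>
            simp only [Option.elim_some, Pi.smul_apply, smul_eq_mul, RingHom.id_apply]
            split_ifs <;> ring }
    let L : Option (Fin N) → (Fin N × Bool × A.Workspace → ℂ) →ₗ[ℂ]
        (Fin N × Bool × A.Workspace → ℂ) := fun o =>
      (Matrix.mulVecLin (A.unitary (t + 1)).val).comp (flip o)
    refine ⟨fun k => L (k 0) (v (Fin.tail k)), fun c => ?_⟩
    have hquery : ∀ ψ : Fin N × Bool × A.Workspace → ℂ,
        query c ψ = flip none ψ + ∑ x, if c x then flip (some x) ψ else 0 := by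
      intro ψ
      funext s
      obtain ⟨x, b, w⟩ := s
      rw [Pi.add_apply, Finset.sum_apply, Finset.sum_eq_single x]
      · cases hc : c x <;> simp [query, flip, hc]
      · intro y _ hy
        split_ifs
        · simp [flip, hy.symm]
        · rfl
      · simp
    have hL : ∀ o, L o (A.stateAfter c t) ∈ Submodule.span ℂ
        (Set.range fun k : Fin (t + 1) → Option (Fin N) => L (k 0) (v (Fin.tail k))) := by
      intro o
      refine Submodule.span_mono ?_ (Submodule.apply_mem_span_image_of_mem_span (L o) (hv c))
      rintro _ ⟨_, ⟨k, rfl⟩, rfl⟩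
      exact ⟨Fin.cons o k, by simp⟩
    have hstate : A.stateAfter c (t + 1) = L none (A.stateAfter c t) +
        ∑ x, if c x then L (some x) (A.stateAfter c t) else 0 := by
      rw [stateAfter, hquery, ← Matrix.mulVecLin_apply, map_add, map_sum]
      refine congrArg₂ _ rfl (Finset.sum_congr rfl fun x _ => ?_)
      split_ifs
      · rfl
      · exact map_zero _
    rw [hstate]
    refine Submodule.add_mem _ (hL none) (Submodule.sum_mem _ fun x _ => ?_)
    split_ifs
    · exact hL _
    · exact Submodule.zero_mem _

end QuantumLearner

/-- Unit vectors of a `d`-dimensional space carry a total mass of at most `d` on disjoint sets of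
coordinates. -/
theorem sum_mass_le_finrank {ι κ : Type} [Fintype ι] (C : Finset κ)
    (W : Submodule ℂ (EuclideanSpace ℂ ι)) (ψ : κ → EuclideanSpace ℂ ι)
    (hψ : ∀ c ∈ C, ψ c ∈ W) (hn : ∀ c ∈ C, ‖ψ c‖ = 1) (F : κ → Finset ι)
    (hF : (C : Set κ).PairwiseDisjoint F) :
    ∑ c ∈ C, ∑ s ∈ F c, ‖ψ c s‖ ^ 2 ≤ Module.finrank ℂ W := by
  classical
  let e := stdOrthonormalBasis ℂ W
  -- By Cauchy-Schwarz, a coordinate of a unit vector of `W` is bounded by the diagonal entry of the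
  -- projection onto `W`. These entries sum to the trace, which is the dimension.
  have hpt : ∀ c ∈ C, ∀ s, ‖ψ c s‖ ^ 2 ≤ ∑ k, ‖(e k : EuclideanSpace ℂ ι) s‖ ^ 2 := by
    intro c hc s
    let p : W := ⟨ψ c, hψ c hc⟩
    have h1 : ψ c s = ∑ k, e.repr p k * (e k : EuclideanSpace ℂ ι) s := by
      have := congrArg (fun y : W => (y : EuclideanSpace ℂ ι) s) (e.sum_repr p)
      simpa [p, Submodule.coe_sum] using this.symm
    have h2 : ∑ k, ‖e.repr p k‖ ^ 2 = 1 := by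
      rw [← EuclideanSpace.norm_sq_eq, e.repr.norm_map]
      have : ‖p‖ = 1 := hn c hc
      rw [this, one_pow]
    calc ‖ψ c s‖ ^ 2 ≤ (∑ k, ‖e.repr p k‖ * ‖(e k : EuclideanSpace ℂ ι) s‖) ^ 2 := by
          gcongr
          rw [h1]
          refine (norm_sum_le _ _).trans_eq ?_
          simp only [norm_mul]
      _ ≤ (∑ k, ‖e.repr p k‖ ^ 2) * ∑ k, ‖(e k : EuclideanSpace ℂ ι) s‖ ^ 2 :=
          Finset.sum_mul_sq_le_sq_mul_sq _ _ _
      _ = _ := by rw [h2, one_mul]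
  calc ∑ c ∈ C, ∑ s ∈ F c, ‖ψ c s‖ ^ 2
      ≤ ∑ c ∈ C, ∑ s ∈ F c, ∑ k, ‖(e k : EuclideanSpace ℂ ι) s‖ ^ 2 :=
        Finset.sum_le_sum fun c hc => Finset.sum_le_sum fun s _ => hpt c hc s
    _ = ∑ s ∈ C.biUnion F, ∑ k, ‖(e k : EuclideanSpace ℂ ι) s‖ ^ 2 :=
        (Finset.sum_biUnion hF).symm
    _ ≤ ∑ s, ∑ k, ‖(e k : EuclideanSpace ℂ ι) s‖ ^ 2 :=
        Finset.sum_le_sum_of_subset_of_nonneg (Finset.subset_univ _) fun _ _ _ => by positivity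
    _ = ∑ k, ‖(e k : EuclideanSpace ℂ ι)‖ ^ 2 := by
        rw [Finset.sum_comm]
        simp only [EuclideanSpace.norm_sq_eq]
    _ = Module.finrank ℂ W := by
        have : ∀ k, ‖(e k : EuclideanSpace ℂ ι)‖ = 1 := fun k => e.orthonormal.1 k
        simp [this]

/-- The information lower bound for quantum learners. -/
theorem card_le_of_quantumLearnable {N : ℕ} {C : Finset (Fin N → Bool)} {q : ℕ}
    (hC : QuantumLearnable C q) : 2 / 3 * (C.card : ℝ) ≤ ((N : ℝ) + 1) ^ q := by
  classical
  obtain ⟨A, hA⟩ := hC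
  obtain ⟨v, hv⟩ := A.exists_spanning_family q
  let E := (WithLp.linearEquiv 2 ℂ (Fin N × Bool × A.Workspace → ℂ)).symm
  let W := Submodule.span ℂ (Set.range fun k => E (v k))
  have hW : (Module.finrank ℂ W : ℝ) ≤ ((N : ℝ) + 1) ^ q := by
    have : Module.finrank ℂ W ≤ Fintype.card (Fin q → Option (Fin N)) :=
      finrank_range_le_card fun k => E (v k)
    simp only [Fintype.card_fun, Fintype.card_option, Fintype.card_fin] at this
    exact_mod_cast this
  have h := sum_mass_le_finrank C W (fun c => E (A.stateAfter c q))
    (fun c _ => by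
      have := Submodule.apply_mem_span_image_of_mem_span E.toLinearMap (hv c)
      rwa [← Set.range_comp] at this)
    (fun c _ => by
      rw [EuclideanSpace.norm_eq, Real.sqrt_eq_one]
      exact A.sum_norm_sq_stateAfter c q)
    (fun c => Finset.univ.filter fun s => A.output s = c)
    (fun c _ d _ hcd => Finset.disjoint_filter.mpr fun s _ h1 h2 => hcd (h1.symm.trans h2))
  refine le_trans ?_ (h.trans hW)
  calc 2 / 3 * (C.card : ℝ) = ∑ c ∈ C, (2 / 3 : ℝ) := by rw [Finset.sum_const, nsmul_eq_mul]; ring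
    _ ≤ _ := Finset.sum_le_sum fun c hc => by
      have := hA c hc
      rw [QuantumLearner.successProb] at this
      change _ ≤ ∑ s with A.output s = c, ‖A.stateAfter c q s‖ ^ 2
      convert this

/-! ### Choice of constants -/

theorem classicallyLearnable_zero_of_card_le_one {N : ℕ} {C : Finset (Fin N → Bool)}
    (hC : C.card ≤ 1) : ClassicallyLearnable C 0 := by
  obtain ⟨h, hh⟩ : ∃ h, ∀ c ∈ C, c = h := by
    rcases C.eq_empty_or_nonempty with rfl | ⟨h, hh⟩
    · exact ⟨fun _ => false, by simp⟩
    · exact ⟨h, fun c hc => Finset.card_le_one.mp hC c hc h hh⟩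
  refine ⟨PMF.pure (.leaf h), ?_, fun c hc => ?_⟩
  · intro s hs
    simp only [PMF.support_pure, Set.mem_singleton_iff] at hs
    rw [hs]; rfl
  · rw [hh c hc, PMF.pure_map]
    simpa [DecisionTree.run] using ENNReal.div_le_of_le_mul (by norm_num)

/-- The error of 1/3 is split in two: a sixth from leaves naming a dominating concept, and a sixth
from running out of queries, which is what the factor 6 in `hT` ensures. -/
theorem classicallyLearnable_of_balanced {N : ℕ} (C : Finset (Fin N → Bool)) {ρ : ℝ}
    (hρ : 0 < ρ)
    (hbal : ∀ (μ : (Fin N → Bool) → ℝ), (∀ c, 0 ≤ μ c) → ∀ S ⊆ C, 0 < ∑ c ∈ S, μ c →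
      (∀ c ∈ S, μ c ≤ 5 / 6 * ∑ c ∈ S, μ c) →
      ∃ x, ∀ b, ρ * ∑ c ∈ S, μ c ≤ ∑ c ∈ S with c x = b, μ c)
    {T : ℕ} (hT0 : 0 < T * (ρ * Real.log ρ⁻¹))
    (hT : 6 * Real.log C.card ≤ T * (ρ * Real.log ρ⁻¹)) : ClassicallyLearnable C T := by
  refine classicallyLearnable_of_forall_weight C T fun μ hμ h1 => ?_
  obtain ⟨t, U, ht, -, he, hU⟩ := exists_decisionTree_error_le C μ (fun c _ => hμ c) hρ
    (hbal μ hμ) T C subset_rfl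
  have hent := massEntropy_le_log_card C μ (fun c _ => hμ c) h1
  have hU6 : U ≤ 1 / 6 := by
    by_contra! hlt
    have := mul_lt_mul_of_pos_left hlt hT0
    linarith
  refine ⟨t, ht, ?_⟩
  have hs := Finset.sum_filter_add_sum_filter_not C (fun c => t.run c = c) μ
  rw [h1] at he hs
  linarith

theorem card_le_one_of_quantumLearnable_zero {N : ℕ} {C : Finset (Fin N → Bool)}
    (hC : QuantumLearnable C 0) : C.card ≤ 1 := by
  have := card_le_of_quantumLearnable hC
  rw [pow_zero] at this
  by_contra! h
  have : (2 : ℝ) ≤ C.card := by exact_mod_cast h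
  linarith

theorem log_succ_pos {q : ℕ} (hq : 1 ≤ q) : 0 < Real.log ((q : ℝ) + 1) :=
  Real.log_pos (by have : (1 : ℝ) ≤ q := by exact_mod_cast hq
                   linarith)

theorem exists_classicallyLearnable_le {N : ℕ} {C : Finset (Fin N → Bool)} {q : ℕ}
    (hC : QuantumLearnable C q) :
    ∃ T : ℕ, ClassicallyLearnable C T ∧
      (T : ℝ) ≤ 10 ^ 6 * ((q : ℝ) ^ 2 / Real.log (q + 1) * Real.log C.card) := by
  rcases le_or_gt C.card 1 with hcard | hcard
  · refine ⟨0, classicallyLearnable_zero_of_card_le_one hcard, ?_⟩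
    rw [Nat.cast_zero]
    exact mul_nonneg (by norm_num) (mul_nonneg (div_nonneg (by positivity)
      (Real.log_nonneg (by have := Nat.cast_nonneg (α := ℝ) q; linarith)))
      (Real.log_natCast_nonneg _))
  have hq : 1 ≤ q := by
    by_contra! h0
    obtain rfl : q = 0 := by omega
    have := card_le_one_of_quantumLearnable_zero hC
    omega
  have hq1 : (1 : ℝ) ≤ q := by exact_mod_cast hq
  have hlq := log_succ_pos hq
  set ℓ := Real.log ((q : ℝ) + 1) with hℓ
  set L := Real.log C.card with hL
  have hL2 : 1 / 2 ≤ L := by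
    have h2 : Real.log 2 ≤ L := Real.log_le_log (by norm_num) (by exact_mod_cast hcard)
    linarith [Real.log_two_gt_d9]
  have hlq_le : ℓ ≤ q := by
    have := Real.log_le_sub_one_of_pos (x := (q : ℝ) + 1) (by linarith)
    linarith
  -- 217 is the first integer above 216, so that `q * (2 * r) = 2 / 217 < 1 / 108`.
  set r : ℝ := (217 * q)⁻¹ with hr
  have hrpos : 0 < r := by positivity
  have hqr : (q : ℝ) * (2 * r) < 1 / 108 := by
    have : (q : ℝ) * (2 * r) = 2 / 217 := by rw [hr]; field_simp
    rw [this]; norm_num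
  have hlog : ℓ ≤ Real.log (r ^ 2)⁻¹ := by
    refine Real.log_le_log (by linarith) ?_
    rw [hr, inv_pow, inv_inv]
    nlinarith
  set h := r ^ 2 * Real.log (r ^ 2)⁻¹ with hh
  have hr2 : r ^ 2 * ℓ ≤ h := mul_le_mul_of_nonneg_left hlog (by positivity)
  have hr2pos : 0 < r ^ 2 * ℓ := by positivity
  set T := ⌈6 * L / (r ^ 2 * ℓ)⌉₊ with hT
  have hTge : 6 * L / (r ^ 2 * ℓ) ≤ T := Nat.le_ceil _
  have hTlt : (T : ℝ) < 6 * L / (r ^ 2 * ℓ) + 1 := Nat.ceil_lt_add_one (by positivity)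
  have hTh : 6 * L ≤ T * h := by
    rw [div_le_iff₀ hr2pos] at hTge
    exact hTge.trans (mul_le_mul_of_nonneg_left hr2 (Nat.cast_nonneg T))
  refine ⟨T, classicallyLearnable_of_balanced C (ρ := r ^ 2) (by positivity)
    (fun μ hμ S hS hpos hatom => exists_balanced_point hC hS μ (fun c _ => hμ c) hpos hatom hrpos
      hqr) (by linarith) hTh, ?_⟩
  have h1 : 6 * L / (r ^ 2 * ℓ) = 6 * 217 ^ 2 * ((q : ℝ) ^ 2 / ℓ * L) := by
    rw [hr]; field_simp
  -- The rounding up in `T` is absorbed into the main term, which is bounded below because `|C| ≥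
  -- 2`; in total `6 * 217 ^ 2 + 2 ≤ 10 ^ 6`.
  have h2 : 1 ≤ 2 * ((q : ℝ) ^ 2 / ℓ * L) := by
    have : 1 ≤ (q : ℝ) ^ 2 / ℓ := by rw [le_div_iff₀ hlq]; nlinarith
    nlinarith
  linarith

theorem log_card_le_of_quantumLearnable {N : ℕ} (hN : 2 ≤ N) {C : Finset (Fin N → Bool)} {q : ℕ}
    (hq : 1 ≤ q) (hC : QuantumLearnable C q) :
    Real.log C.card ≤ 3 * (q * Real.log N) := by
  have hN' : (2 : ℝ) ≤ N := by exact_mod_cast hN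
  have hq1 : (1 : ℝ) ≤ q := by exact_mod_cast hq
  have hlogN : 0 ≤ Real.log N := Real.log_nonneg (by linarith)
  rcases C.eq_empty_or_nonempty with rfl | hne
  · simp; positivity
  have hc : (0 : ℝ) < C.card := by exact_mod_cast hne.card_pos
  -- Here `3 / 2 ≤ N` and `N + 1 ≤ N ^ 2`, so the exponent of `N` is `1 + 2 * q ≤ 3 * q`.
  have h1 : (C.card : ℝ) ≤ N * ((N : ℝ) ^ 2) ^ q := by
    have h2 := card_le_of_quantumLearnable hC
    have h3 : ((N : ℝ) + 1) ^ q ≤ ((N : ℝ) ^ 2) ^ q := by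
      gcongr
      nlinarith
    have h4 : (0 : ℝ) ≤ ((N : ℝ) ^ 2) ^ q := by positivity
    nlinarith
  have h5 := Real.log_le_log hc h1
  rw [Real.log_mul (by positivity) (by positivity), Real.log_pow, Real.log_pow] at h5
  push_cast at h5
  nlinarith

theorem sq_div_log_mul_log_card_le {N : ℕ} (hN : 2 ≤ N) {C : Finset (Fin N → Bool)} {q : ℕ}
    (hC : QuantumLearnable C q) :
    (q : ℝ) ^ 2 / Real.log (q + 1) * Real.log C.card ≤
      10 ^ 6 * ((q : ℝ) ^ 3 / Real.log (q + 1) * Real.log N) := by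
  rcases Nat.eq_zero_or_pos q with rfl | hq
  · simp
  have hlq := log_succ_pos hq
  have hlogN : 0 ≤ Real.log N := Real.log_natCast_nonneg N
  calc (q : ℝ) ^ 2 / Real.log (q + 1) * Real.log C.card
      ≤ (q : ℝ) ^ 2 / Real.log (q + 1) * (3 * (q * Real.log N)) := by
        gcongr
        exact log_card_le_of_quantumLearnable hN hq hC
    _ = 3 * ((q : ℝ) ^ 3 / Real.log (q + 1) * Real.log N) := by ring
    _ ≤ 10 ^ 6 * ((q : ℝ) ^ 3 / Real.log (q + 1) * Real.log N) := by
        gcongr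
        norm_num

end ExactLearning

theorem mainTheorem7 :
    ∃ K : ℝ, 0 < K ∧ ∀ (N : ℕ), 1 ≤ N → ∀ C : Finset (Fin N → Bool),
      ((ExactLearning.R C : ℝ) ≤
          K * ((ExactLearning.Q C : ℝ) ^ 2 / Real.log (ExactLearning.Q C + 1) * Real.log C.card) ∧
        (2 ≤ N →
          (ExactLearning.Q C : ℝ) ^ 2 / Real.log (ExactLearning.Q C + 1) * Real.log C.card ≤
            K * ((ExactLearning.Q C : ℝ) ^ 3 / Real.log (ExactLearning.Q C + 1) * Real.log N))) ∧
      ∀ q : ℕ, ExactLearning.QuantumLearnable C q →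
        ∃ T : ℕ, ExactLearning.ClassicallyLearnable C T ∧
          (T : ℝ) ≤ K * ((q : ℝ) ^ 2 / Real.log (q + 1) * Real.log C.card) ∧
          (2 ≤ N →
            (q : ℝ) ^ 2 / Real.log (q + 1) * Real.log C.card ≤
              K * ((q : ℝ) ^ 3 / Real.log (q + 1) * Real.log N)) := by
  refine ⟨10 ^ 6, by norm_num, fun N hN C => ⟨⟨?_, fun hN2 => ?_⟩, fun q hC => ?_⟩⟩
  · obtain ⟨T, hT, hle⟩ :=
      ExactLearning.exists_classicallyLearnable_le (ExactLearning.quantumLearnable_Q hN C)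
    have hR : ExactLearning.R C ≤ T := Nat.sInf_le hT
    exact (Nat.cast_le.mpr hR).trans hle
  · exact ExactLearning.sq_div_log_mul_log_card_le hN2 (ExactLearning.quantumLearnable_Q hN C)
  · obtain ⟨T, hT, hle⟩ := ExactLearning.exists_classicallyLearnable_le hC
    exact ⟨T, hT, hle, fun hN2 => ExactLearning.sq_div_log_mul_log_card_le hN2 hC⟩
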